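/- A commutative post-Lie algebra structure on a Lie algebra $L$ over a field $\mathbb{F}$ is an $\mathbb{F}$-bilinear product $x\cdot y$ on $L$ such that, for all $x,y,z\in L$, $$x\cdot y=y\cdot x,\qquad [x,y]\cdot z=x\cdot(y\cdot z)-y\cdot(x\cdot z),\qquad x\cdot[y,z]=[x\cdot y,z]+[y,x\cdot z].$$ It is trivial if $x\cdot y=0$ for all $x,y\in L$. A Lie algebra $L$ over a field $\mathbb{F}$ of characteristic not $2$ or $3$ is called classical if its centre is $0$, $[L,L]=L$, and $L$ has an abelian Cartan subalgebra $\mathfrak{h}$ such that, with $L_\alpha=\{x\in L\mid [h,x]=\alpha(h)x \text{ for all } h\in\mathfrak{h}\}$ for $\alpha\in\mathfrak{h}^*$ and with $\alpha$ called a root if $L_\alpha\neq0$ (so that $0$ may be a root): (a) $L=\bigoplus_\alpha L_\alpha$; (b) $[L_\alpha,L_{-\alpha}]$ is one-dimensional for every root $\alpha\ne0$; (c) for all roots $\alpha,\beta$ with $\beta\neq0$, not all $\alpha+k\beta$ $(k\in\mathbb{Z})$ are roots. **Theorem.** (1) Let $\mathbb{F}$ be a field of characteristic not $2$ or $3$,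 and let $L$ be a finite-dimensional simple Lie algebra over $\mathbb{F}$ that is classical or whose Killing form is non-degenerate. Then every commutative post-Lie algebra structure on $L$ is trivial. (2) Let $\mathbb{F}$ be a field of characteristic $0$, let $n\geq1$, and let $\mathcal{W}_n^+=\mathrm{Der}(\mathbb{F}[t_1,\dots,t_n])$ be the Witt algebra, i.e. the Lie algebra of $\mathbb{F}$-linear derivations of the polynomial algebra with the commutator bracket. Then every commutative post-Lie algebra structure on $\mathcal{W}_n^+$ is trivial. -/

import Mathlib

universe u v

/-- A bilinear product `mul` on a Lie algebra `L` over `F` is a commutative post-Lie algebra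
structure if, writing `x · y` for `mul x y`, it satisfies the three identities below. -/
structure IsCommPostLie (F : Type u) (L : Type v) [Field F] [LieRing L] [LieAlgebra F L]
    (mul : L →ₗ[F] L →ₗ[F] L) : Prop where
  /-- `x · y = y · x` -/
  comm : ∀ x y : L, mul x y = mul y x
  /-- `[x, y] · z = x · (y · z) - y · (x · z)` -/
  lie_mul : ∀ x y z : L, mul ⁅x, y⁆ z = mul x (mul y z) - mul y (mul x z)
  /-- `x · [y, z] = [x · y, z] + [y, x · z]` -/
  mul_lie : ∀ x y z : L, mul x ⁅y, z⁆ = ⁅mul x y, z⁆ + ⁅y, mul x z⁆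

/-- The joint eigenspace `L_α = {x ∈ L | [h, x] = α(h) x for all h ∈ H}` of a subalgebra `H`
acting on `L`, for a linear functional `α` on `H`. -/
def rootSubspace {F : Type u} {L : Type v} [Field F] [LieRing L] [LieAlgebra F L]
    (H : LieSubalgebra F L) (α : Module.Dual F H) : Submodule F L :=
  (LieModule.weightSpace L (α : H → F)).toSubmodule

/-- `H` is a classical Cartan subalgebra of `L`: an abelian Cartan subalgebra that
acts diagonalizably on `L` with all eigenvalues in the ground field, such that `[L_α, L_{-α}]` is
one-dimensional for each nonzero root `α`, and such that no string `α + ℤβ` in the direction of a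
nonzero root `β` consists entirely of roots. (A functional `α` is a root if `L_α ≠ 0`; in the
last condition `α = 0` counts as a root.) -/
structure IsClassicalCartan (F : Type u) (L : Type v) [Field F] [LieRing L] [LieAlgebra F L]
    (H : LieSubalgebra F L) : Prop where
  cartan : H.IsCartanSubalgebra
  abelian : IsLieAbelian H
  iSup_eq_top : ⨆ α : Module.Dual F H, rootSubspace H α = ⊤
  finrank_coroot : ∀ α : Module.Dual F H, α ≠ 0 → rootSubspace H α ≠ ⊥ →
    Module.finrank F (Submodule.span F
      {z : L | ∃ x ∈ rootSubspace H α, ∃ y ∈ rootSubspace H (-α), ⁅x, y⁆ = z}) = 1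
  string : ∀ α β : Module.Dual F H, rootSubspace H α ≠ ⊥ → β ≠ 0 → rootSubspace H β ≠ ⊥ →
    ∃ k : ℤ, rootSubspace H (α + k • β) = ⊥

/-- A classical Lie algebra over a field of characteristic different from `2` and `3`, in the
sense of Seligman: centreless, perfect, and with a classical Cartan subalgebra. The simple
ones are the split simple Lie algebras obtained from Chevalley bases of types `A` to `G`, modulo
their centres. -/
structure IsClassicalLie (F : Type u) (L : Type v) [Field F] [LieRing L] [LieAlgebra F L] :
    Prop where
  center_eq_bot : LieAlgebra.center F L = ⊥
  perfect : ⁅(⊤ : LieIdeal F L), (⊤ : LieIdeal F L)⁆ = ⊤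
  exists_cartan : ∃ H : LieSubalgebra F L, IsClassicalCartan F L H

/-- The Witt algebra `W_n⁺ = Der F[t₁, …, tₙ]`, with the commutator bracket. -/
abbrev WittPlus (F : Type u) [Field F] (n : ℕ) : Type u :=
  Derivation F (MvPolynomial (Fin n) F) (MvPolynomial (Fin n) F)

/-!
Left multiplication by `x` in a commutative post-Lie structure is a derivation `D x` of `L`, and
`x ↦ D x` is a homomorphism into the Lie algebra of derivations of `L`. The theorem follows from
two facts about a simple Lie algebra `L` over a field of characteristic not `2`.

First, a structure with `D x = ad (T x)` for all `x` is zero. Here `T` is an endomorphism of `L`,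
and commutativity says that `⁅T x, y⁆ = -⁅x, T y⁆`. The kernel of `T` is an ideal, so it is enough
to exclude that `T` is injective. In that case the Jacobi identity forces `T² = 1`
(`apply_apply_eq_self_of_lie_skew`), so `T ⁅x, y⁆ = -⁅x, y⁆`, while comparing brackets gives
`T = 1`; see `mul_eq_zero_of_forall_exists_lie`. No finiteness is needed, so this covers the Witt
algebra.

Second, if commutators of derivations of `L` are inner then all `D x` are inner, because the `x`
with `D x` inner form an ideal containing all brackets (`mul_eq_zero_of_derivation_lie_inner`). It
remains to verify this property in each case.

* If the Killing form is non-degenerate, all derivations are inner.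
* If `L` is classical, there may be outer derivations, but every derivation agrees on the Cartan
  subalgebra with an inner one (`IsClassicalCartan.exists_derivation_apply_eq_lie`), and the
  derivations killing the Cartan subalgebra preserve the root spaces. These are one-dimensional
  (`IsClassicalCartan.exists_eq_smul`), so such derivations commute.
* The Witt algebra is simple (`WittPlus.isSimple`) and all its derivations are inner
  (`WittPlus.exists_derivation_eq_lie`). Both facts use the grading by the Euler vector field.
-/

/-! ### Commutative post-Lie structures with inner multiplications -/

/-- An injective endomorphism `T` of a centreless Lie algebra without `2`-torsion that is skew for
the bracket is an involution.

With `S = T²`, the trilinear map `⁅⁅a, b⁆, c⁆` satisfies `S₁ = S₂` and `S₁² = S₃`, where `Sᵢ`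
denotes `S` acting on the `i`-th argument. Combined with the Jacobi identity these two relations
force first `(S - 1)² = 0` and then `S = 1`. -/
theorem apply_apply_eq_self_of_lie_skew {L : Type*} [LieRing L]
    (h2 : ∀ x : L, x + x = 0 → x = 0)
    (hcenter : ∀ x : L, (∀ y : L, ⁅x, y⁆ = (0 : L)) → x = 0)
    (T : L →+ L) (hT : Function.Injective T) (hlie : ∀ x y, T ⁅x, y⁆ = ⁅T x, T y⁆)
    (hskew : ∀ x y, ⁅T x, y⁆ = -⁅x, T y⁆) (x : L) : T (T x) = x := by
  have hcenter₂ : ∀ x : L, (∀ y z : L, ⁅⁅x, y⁆, z⁆ = (0 : L)) → x = 0 := fun x hx =>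
    hcenter x fun y => hcenter _ fun z => hx y z
  have h4 : ∀ x : L, x + x + x + x = 0 → x = 0 := fun x hx =>
    h2 _ (h2 _ (by rw [← add_assoc]; exact hx))
  have jac : ∀ a b c : L, ⁅⁅a, b⁆, c⁆ + ⁅⁅b, c⁆, a⁆ + ⁅⁅c, a⁆, b⁆ = 0 := fun a b c => by
    rw [← lie_skew ⁅a, b⁆ c, ← lie_skew ⁅b, c⁆ a, ← lie_skew ⁅c, a⁆ b, ← neg_add, ← neg_add,
      neg_eq_zero, ← lie_jacobi a b c]
    abel
  obtain ⟨S, hS⟩ : ∃ S : L →+ L, ∀ x, S x = T (T x) := ⟨T.comp T, fun _ => rfl⟩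
  have hSinj : Function.Injective S := fun x y h => hT (hT (by rwa [hS, hS] at h))
  have hsymm : ∀ x y, ⁅S x, y⁆ = ⁅x, S y⁆ := fun x y => by
    rw [hS, hS, hskew, hskew, neg_neg]
  have hTlie : ∀ x y, T ⁅x, y⁆ = -⁅S x, y⁆ := fun x y => by
    rw [hlie, hskew, hsymm, hS]
  have hSlie : ∀ x y, S ⁅x, y⁆ = ⁅S (S x), y⁆ := fun x y => by
    rw [hS, hTlie, map_neg, hTlie, neg_neg]
  have hG₁ : ∀ a b c : L, ⁅⁅S a, b⁆, c⁆ = ⁅⁅a, S b⁆, c⁆ := fun a b c => by rw [hsymm]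
  have hG₂ : ∀ a b c : L, ⁅⁅a, b⁆, S c⁆ = ⁅⁅S (S a), b⁆, c⁆ := fun a b c => by
    rw [← hsymm, hSlie]
  -- Apply `(S₂ - S₃)(S₃ - S₁)` to the Jacobi identity: it kills the second and third summands, on
  -- which `S₂ = S₃` and `S₃ = S₁` respectively, and acts on the first as `-(S₁² - S₁)²`.
  have hquad : ∀ a, S (S (S (S a))) - S (S (S a)) - (S (S (S a)) - S (S a)) = 0 := by
    intro a
    refine hcenter₂ _ fun b c => ?_
    have e1 := jac a (S b) (S c)
    have e2 := jac (S a) (S b) c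
    have e3 := jac a b (S (S c))
    have e4 := jac (S a) b (S c)
    simp only [← hG₁, hG₂] at e1 e2 e3 e4
    simp only [sub_lie]
    generalize ⁅⁅S (S b), c⁆, a⁆ = P₁ at *
    generalize ⁅⁅S (S (S b)), c⁆, a⁆ = P₂ at *
    linear_combination (norm := module) e2 + e3 - e1 - e4
  have hN₂ : ∀ a, S (S a) - S a - (S a - a) = 0 := fun a => by
    apply hSinj; apply hSinj; simpa using hquad a
  -- The relations for `S = 1 + N` with `N² = 0` become `N₁ = N₂` and `2 N₁ = N₃`.
  obtain ⟨N, hN⟩ : ∃ N : L →+ L, ∀ x, N x = S x - x := ⟨S - AddMonoidHom.id L, fun _ => rfl⟩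
  have hn₁ : ∀ a b c : L, ⁅⁅a, N b⁆, c⁆ = ⁅⁅N a, b⁆, c⁆ := fun a b c => by
    simp only [hN, lie_sub, sub_lie, hG₁]
  have hn₂ : ∀ a b c : L, ⁅⁅a, b⁆, N c⁆ = ⁅⁅N a, b⁆, c⁆ + ⁅⁅N a, b⁆, c⁆ := fun a b c => by
    have : S (S a) = S a + S a - a := by
      rw [← sub_eq_zero, ← hN₂ a]; abel
    simp only [hN, lie_sub, sub_lie, hG₂, this, add_lie]
    abel
  have hN0 : N x = 0 := by
    refine hcenter₂ _ fun b c => ?_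
    -- Moving `N` through the three arguments of the Jacobi identity gives three linear relations
    -- between `P`, `Q` and `R`, of determinant a power of `2`.
    have e1 := jac (N x) b c
    have e2 := jac x (N b) c
    have e3 := jac x b (N c)
    simp only [hn₁, hn₂] at e1 e2 e3
    generalize ⁅⁅N x, b⁆, c⁆ = P at *
    generalize ⁅⁅N b, c⁆, x⁆ = Q at *
    generalize ⁅⁅N c, x⁆, b⁆ = R at *
    have e4 : P + Q + R = 0 := h4 _ (by
      calc _ = (P + (Q + Q) + R) + (P + Q + (R + R)) + (P + P + Q + R) := by abel
        _ = 0 := by rw [e1, e2, e3]; simp)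
    calc P = (P + P + Q + R) - (P + Q + R) := by abel
      _ = 0 := by rw [e3, e4, sub_zero]
  rw [← hS, ← sub_eq_zero, ← hN, hN0]

/-- If all left multiplications of a commutative post-Lie structure are inner, `x · y = ⁅T x, y⁆`,
then `T` is a Lie homomorphism which commutativity makes skew for the bracket. Its kernel is an
ideal, and an injective `T` would be at once the identity and minus the identity. -/
theorem mul_eq_zero_of_forall_exists_lie {F L : Type*} [Field F] [LieRing L] [LieAlgebra F L]
    [LieAlgebra.IsSimple F L] (h2 : (2 : F) ≠ 0) {mul : L →ₗ[F] L →ₗ[F] L}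
    (h : IsCommPostLie F L mul) (hinner : ∀ x, ∃ u : L, ∀ y, mul x y = ⁅u, y⁆) (x y : L) :
    mul x y = 0 := by
  have hnab := LieAlgebra.IsSimple.non_abelian F (L := L)
  have hcen : LieAlgebra.center F L = ⊥ := LieAlgebra.center_eq_bot F L
  have hcenter : ∀ x : L, (∀ y : L, ⁅x, y⁆ = (0 : L)) → x = 0 := by
    intro x hx
    have : x ∈ LieAlgebra.center F L := by
      rw [LieModule.mem_maxTrivSubmodule]
      intro y; rw [← lie_skew, hx, neg_zero]
    simpa [hcen] using this
  have hext : ∀ u v : L, (∀ y : L, ⁅u, y⁆ = ⁅v, y⁆) → u = v := fun u v huv => by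
    rw [← sub_eq_zero]; exact hcenter _ fun y => by rw [sub_lie, huv, sub_self]
  choose φ hφ using hinner
  let T : L →ₗ[F] L :=
    { toFun := φ
      map_add' := fun a b => hext _ _ fun y => by rw [add_lie, ← hφ, ← hφ, ← hφ]; simp
      map_smul' := fun a b => hext _ _ fun y => by
        rw [RingHom.id_apply, smul_lie, ← hφ, ← hφ]; simp }
  have hT : ∀ x y, mul x y = ⁅T x, y⁆ := hφ
  have hlie : ∀ x y, T ⁅x, y⁆ = ⁅T x, T y⁆ := fun a b => hext _ _ fun y => by
    rw [← hT, h.lie_mul, hT, hT, hT, hT, lie_lie]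
  have hskew : ∀ x y, ⁅T x, y⁆ = -⁅x, T y⁆ := fun a b => by
    rw [← hT, h.comm, hT, lie_skew]
  let I : LieIdeal F L :=
    { LinearMap.ker T with
      lie_mem := fun {a b} hb => by
        have hb : T b = 0 := hb
        change T ⁅a, b⁆ = 0
        rw [hlie, hb, lie_zero] }
  rcases LieAlgebra.IsSimple.eq_bot_or_eq_top (R := F) I with hI | hI
  · exfalso
    have h2' : ∀ x : L, x + x = 0 → x = 0 := fun x hx => by
      rw [← two_smul F x] at hx
      exact (smul_eq_zero.1 hx).resolve_left h2
    have hinj : Function.Injective T := by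
      rw [← LinearMap.ker_eq_bot]
      have : I.toSubmodule = ⊥ := by rw [hI]; rfl
      exact this
    have hTT := apply_apply_eq_self_of_lie_skew h2' hcenter T.toAddMonoidHom hinj hlie hskew
    have hneg : ∀ a b : L, T ⁅a, b⁆ = -⁅a, b⁆ := fun a b => by
      rw [hlie, hskew]
      congr 2; exact hTT b
    have hfix : ∀ b : L, T b = b := by
      intro b
      rw [← sub_eq_zero]
      have hy : ∀ c d : L, ⁅⁅c, d⁆, T b - b⁆ = 0 := fun c d => by
        rw [lie_sub, ← neg_neg ⁅⁅c, d⁆, T b⁆, ← hskew, hneg, neg_lie, neg_neg, sub_self]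
      -- The centralizer of all brackets is a proper ideal.
      let J : LieIdeal F L :=
        { carrier := {z | ∀ c d : L, ⁅⁅c, d⁆, z⁆ = 0}
          zero_mem' := fun c d => lie_zero _
          add_mem' := fun {u v} hu hv c d => by rw [lie_add, hu, hv, add_zero]
          smul_mem' := fun r u hu c d => by rw [lie_smul, hu, smul_zero]
          lie_mem := fun {w u} hu c d => by rw [leibniz_lie, hu, hu, lie_zero, add_zero] }
      rcases LieAlgebra.IsSimple.eq_bot_or_eq_top (R := F) J with hJ | hJ
      · have : T b - b ∈ J := hy
        simpa [hJ] using this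
      · exact absurd ⟨fun c d => hcenter _ fun z => (hJ ▸ trivial : z ∈ J) c d⟩ hnab
    refine hnab ⟨fun a b => h2' _ ?_⟩
    have := hneg a b
    rw [hfix] at this
    nth_rw 1 [this]
    exact neg_add_cancel _
  · have : T x = 0 := (by rw [hI]; trivial : x ∈ I)
    rw [hT, this, zero_lie]

/-- The elements with inner left multiplication form an ideal, which contains all brackets as soon
as commutators of derivations are inner. For psl_n in characteristic dividing `n` this weaker
condition holds although not all derivations are inner. -/
theorem mul_eq_zero_of_derivation_lie_inner {F L : Type*} [Field F] [LieRing L] [LieAlgebra F L]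
    [LieAlgebra.IsSimple F L] (h2 : (2 : F) ≠ 0)
    (hinner : ∀ D₁ D₂ : LieDerivation F L L, ∃ u : L, ∀ y, ⁅D₁, D₂⁆ y = ⁅u, y⁆)
    {mul : L →ₗ[F] L →ₗ[F] L} (h : IsCommPostLie F L mul) (x y : L) : mul x y = 0 := by
  let D : L → LieDerivation F L L := fun x =>
    ⟨mul x, fun a b => by rw [h.mul_lie, ← lie_skew (mul x a) b]; abel⟩
  have hD : ∀ x y, D x y = mul x y := fun _ _ => rfl
  have hmem : ∀ a b : L, ∃ u : L, ∀ y, mul ⁅a, b⁆ y = ⁅u, y⁆ := fun a b => by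
    obtain ⟨u, hu⟩ := hinner (D a) (D b)
    refine ⟨u, fun y => ?_⟩
    rw [← hu, h.lie_mul, LieDerivation.lie_apply, hD, hD, hD, hD]
  let I : LieIdeal F L :=
    { carrier := {x | ∃ u : L, ∀ y, mul x y = ⁅u, y⁆}
      zero_mem' := ⟨0, by simp⟩
      add_mem' := by
        rintro a b ⟨u, hu⟩ ⟨v, hv⟩
        exact ⟨u + v, fun y => by simp [hu, hv]⟩
      smul_mem' := by
        rintro c a ⟨u, hu⟩
        exact ⟨c • u, fun y => by simp [hu]⟩
      lie_mem := fun {a b} _ => hmem a b }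
  have hI : I = ⊤ := by
    refine (LieAlgebra.IsSimple.eq_bot_or_eq_top (R := F) I).resolve_left fun hI => ?_
    refine LieAlgebra.IsSimple.non_abelian F (L := L) ⟨fun a b => ?_⟩
    have : ⁅a, b⁆ ∈ I := hmem a b
    simpa [hI] using this
  refine mul_eq_zero_of_forall_exists_lie h2 h (fun x => ?_) x y
  have : x ∈ I := by rw [hI]; trivial
  exact this

/-! ### Derivations of classical Lie algebras -/

section ClassicalCartan

variable {F L : Type*} [Field F] [LieRing L] [LieAlgebra F L]
  {H : LieSubalgebra F L}

theorem mem_rootSubspace {α : Module.Dual F H} {x : L} :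
    x ∈ rootSubspace H α ↔ ∀ h : H, ⁅(h : L), x⁆ = α h • x :=
  LieModule.mem_weightSpace (M := L) (α : H → F) x

theorem lie_mem_rootSubspace {α β : Module.Dual F H} {x y : L} (hx : x ∈ rootSubspace H α)
    (hy : y ∈ rootSubspace H β) : ⁅x, y⁆ ∈ rootSubspace H (α + β) := by
  rw [mem_rootSubspace] at *
  intro h
  rw [leibniz_lie, hx, hy, smul_lie, lie_smul, LinearMap.add_apply, add_smul]

namespace IsClassicalCartan

variable (hH : IsClassicalCartan F L H)
include hH

theorem mem_rootSubspace_zero {x : L} : x ∈ rootSubspace H 0 ↔ x ∈ H := by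
  have := hH.abelian
  rw [mem_rootSubspace]
  constructor
  · intro hx
    rw [← hH.cartan.self_normalizing, LieSubalgebra.mem_normalizer_iff']
    intro y hy
    rw [hx ⟨y, hy⟩, LinearMap.zero_apply, zero_smul]
    exact zero_mem _
  · intro hx h
    have := congrArg Subtype.val (trivial_lie_zero H H h ⟨x, hx⟩)
    simpa using this

theorem iSupIndep_rootSubspace : iSupIndep (rootSubspace H) := by
  have := hH.cartan.nilpotent
  have h1 := LieSubmodule.iSupIndep_toSubmodule.2 (LieModule.iSupIndep_genWeightSpace F H L)
  have h2 := h1.comp (f := fun α : Module.Dual F H => (α : H → F)) DFunLike.coe_injective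
  exact h2.mono fun α => LieModule.weightSpace_le_genWeightSpace L (α : H → F)

theorem finite_roots [FiniteDimensional F L] :
    {α : Module.Dual F H | rootSubspace H α ≠ ⊥}.Finite :=
  WellFoundedGT.finite_ne_bot_of_iSupIndep hH.iSupIndep_rootSubspace

theorem induction_on {P : L → Prop} (hmem : ∀ α, ∀ x ∈ rootSubspace H α, P x)
    (zero : P 0) (add : ∀ x y, P x → P y → P (x + y)) (x : L) : P x :=
  Submodule.iSup_induction (rootSubspace H) (motive := P)
    (hH.iSup_eq_top ▸ Submodule.mem_top) hmem zero add

/-- Going upwards from a root `β` in the direction `α`, the first gap in the string occurs after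
fewer than `char F` steps; in characteristic zero it occurs because there are finitely many roots.
The condition on `i` expresses both cases at once. -/
theorem exists_rootSubspace_eq_bot [FiniteDimensional F L] {α β : Module.Dual F H}
    (hα : α ≠ 0) (hα' : rootSubspace H α ≠ ⊥) (hβ : rootSubspace H β ≠ ⊥) :
    ∃ k : ℕ, rootSubspace H (β + k • α) = ⊥ ∧ ∀ i, 1 ≤ i → i ≤ k → (i : F) ≠ 0 := by
  obtain ⟨p, hp⟩ := CharP.exists F
  rcases Nat.eq_zero_or_pos p with rfl | hpos
  · have := CharP.charP_to_charZero F
    by_contra! hcon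
    have hinj : Function.Injective fun k : ℕ => β + k • α := by
      intro k l hkl
      have : (k : F) • α = (l : F) • α := by
        simpa [Nat.cast_smul_eq_nsmul] using hkl
      exact_mod_cast smul_left_injective F hα this
    refine Set.infinite_of_injective_forall_mem hinj (fun k => ?_) hH.finite_roots
    intro hk
    obtain ⟨i, hi, -, h0⟩ := hcon k hk
    exact (Nat.one_le_iff_ne_zero.1 hi) (by exact_mod_cast h0)
  · obtain ⟨k, hk⟩ := hH.string β α hβ hα hα'
    have hpz : (p : ℤ) ≠ 0 := by exact_mod_cast hpos.ne'
    have hnn := Int.emod_nonneg k hpz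
    have hlt := Int.emod_lt_of_pos k (by exact_mod_cast hpos : (0 : ℤ) < p)
    refine ⟨(k % p).toNat, ?_, fun i hi hik h0 => ?_⟩
    · have : k • α = (k % p).toNat • α := by
        rw [← natCast_zsmul, Int.toNat_of_nonneg hnn]
        nth_rw 1 [← Int.emod_add_mul_ediv k p]
        have : (p : ℤ) • α = 0 := by
          rw [natCast_zsmul, ← Nat.cast_smul_eq_nsmul F, CharP.cast_eq_zero, zero_smul]
        rw [add_smul, mul_comm, mul_smul, this, smul_zero, add_zero]
      rw [← this, hk]
    · rw [CharP.cast_eq_zero_iff F p] at h0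
      have := Nat.le_of_dvd hi h0
      omega

theorem rootSubspace_neg_ne_bot {α : Module.Dual F H} (hα : α ≠ 0)
    (hα' : rootSubspace H α ≠ ⊥) : rootSubspace H (-α) ≠ ⊥ := by
  intro hbot
  have h := hH.finrank_coroot α hα hα'
  have : Submodule.span F
      {z : L | ∃ x ∈ rootSubspace H α, ∃ y ∈ rootSubspace H (-α), ⁅x, y⁆ = z} = ⊥ := by
    rw [Submodule.span_eq_bot]
    rintro _ ⟨x, -, y, hy, rfl⟩
    rw [hbot, Submodule.mem_bot] at hy
    rw [hy, lie_zero]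
  rw [this, finrank_bot] at h
  exact zero_ne_one h

theorem exists_lie_ne_zero {α : Module.Dual F H} (hα : α ≠ 0)
    (hα' : rootSubspace H α ≠ ⊥) :
    ∃ e ∈ rootSubspace H α, ∃ f ∈ rootSubspace H (-α), ⁅e, f⁆ ≠ 0 := by
  by_contra! hcon
  have h := hH.finrank_coroot α hα hα'
  have : Submodule.span F
      {z : L | ∃ x ∈ rootSubspace H α, ∃ y ∈ rootSubspace H (-α), ⁅x, y⁆ = z} = ⊥ := by
    rw [Submodule.span_eq_bot]
    rintro _ ⟨x, hx, y, hy, rfl⟩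
    exact hcon x hx y hy
  rw [this, finrank_bot] at h
  exact zero_ne_one h

omit hH in
/-- Lowering a highest weight vector `v` of weight `β` by `f`, with `⁅e, f⁆ = h`, gives
`e (fᵏ⁺¹ v) = cₖ fᵏ v`, where `cₖ` is the sum of `(β - j α) h` over `j ≤ k`; so `fⁿ v` is nonzero
as long as the `cⱼ` with `j < n` are. The sequence `c` is specified by its recursion. -/
theorem rootSubspace_sub_ne_bot {α β : Module.Dual F H} {e f v : L}
    (hf : f ∈ rootSubspace H (-α)) (hv : v ∈ rootSubspace H β) (hv0 : v ≠ 0) (hev : ⁅e, v⁆ = 0)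
    {h : H} (hh : ⁅e, f⁆ = h) (c : ℕ → F) (hc0 : c 0 = β h)
    (hc : ∀ k : ℕ, c (k + 1) = c k + (β h - (k + 1) * α h)) {n : ℕ} (hn : ∀ j < n, c j ≠ 0) :
    rootSubspace H (β + n • (-α)) ≠ ⊥ := by
  have hw : ∀ k : ℕ, (LieAlgebra.ad F L f ^ k) v ∈ rootSubspace H (β + k • (-α)) := by
    intro k
    induction k with
    | zero => simpa using hv
    | succ k ih =>
      rw [pow_succ', Module.End.mul_apply, LieAlgebra.ad_apply]
      convert lie_mem_rootSubspace hf ih using 1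
      rw [succ_nsmul]; abel_nf
  have hew : ∀ k : ℕ, ⁅e, (LieAlgebra.ad F L f ^ (k + 1)) v⁆
      = c k • (LieAlgebra.ad F L f ^ k) v := by
    intro k
    induction k with
    | zero =>
      rw [zero_add, pow_one, pow_zero, LieAlgebra.ad_apply, Module.End.one_apply, leibniz_lie, hev,
        lie_zero, add_zero, hh, mem_rootSubspace.1 hv, hc0]
    | succ k ih =>
      rw [pow_succ', Module.End.mul_apply, LieAlgebra.ad_apply, leibniz_lie, ih, hh,
        mem_rootSubspace.1 (hw (k + 1)), lie_smul, ← LieAlgebra.ad_apply F L f,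
        ← Module.End.mul_apply, ← pow_succ', ← add_smul, hc]
      congr 1
      simp
      ring
  have hne : ∀ k ≤ n, (LieAlgebra.ad F L f ^ k) v ≠ 0 := by
    intro k
    induction k with
    | zero => intro _; simpa using hv0
    | succ k ih =>
      intro hk h0
      have := hew k
      rw [h0, lie_zero] at this
      exact smul_ne_zero (hn k hk) (ih (by omega)) this.symm
  intro hbot
  have := hw n
  rw [hbot, Submodule.mem_bot] at this
  exact hne n le_rfl this

/-- A coroot is not killed by its root. Otherwise `e`, `f` and `h` span a Heisenberg algebra, and
`h` acts on some string of root spaces as a nonzero scalar, so lowering a highest weight vector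
never stops within the string. -/
theorem apply_lie_ne_zero [FiniteDimensional F L] (hcen : LieAlgebra.center F L = ⊥)
    {α : Module.Dual F H} (hα : α ≠ 0) (hα' : rootSubspace H α ≠ ⊥)
    {e f : L} (he : e ∈ rootSubspace H α) (hf : f ∈ rootSubspace H (-α)) {h : H}
    (hh : ⁅e, f⁆ = h) (h0 : h ≠ 0) : α h ≠ 0 := by
  intro hαh
  obtain ⟨β, hβ, hβh⟩ : ∃ β : Module.Dual F H, rootSubspace H β ≠ ⊥ ∧ β h ≠ 0 := by
    by_contra! hcon
    have : (h : L) ∈ LieAlgebra.center F L := by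
      rw [LieModule.mem_maxTrivSubmodule]
      refine hH.induction_on (fun β x hx => ?_) (zero_lie _) fun x y hx hy => ?_
      · rw [← lie_skew, mem_rootSubspace.1 hx, neg_eq_zero]
        by_cases hβ : rootSubspace H β = ⊥
        · rw [hβ, Submodule.mem_bot] at hx
          rw [hx, smul_zero]
        · rw [hcon β hβ, zero_smul]
      · rw [add_lie, hx, hy, add_zero]
    rw [hcen, LieSubmodule.mem_bot] at this
    exact h0 (Subtype.ext this)
  classical
  have hex : ∃ k : ℕ, rootSubspace H (β + k • α) = ⊥ :=
    (hH.exists_rootSubspace_eq_bot hα hα' hβ).imp fun _ => And.left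
  -- `β + m • α` is the top of the segment of roots that starts at `β`.
  obtain ⟨m, hm⟩ : ∃ m, Nat.find hex = m + 1 := by
    refine Nat.exists_eq_succ_of_ne_zero fun h0 => hβ ?_
    have := Nat.find_spec hex
    rwa [h0, zero_smul, add_zero] at this
  have hm1 := Nat.find_spec hex
  have hm0 : rootSubspace H (β + m • α) ≠ ⊥ := Nat.find_min hex (by omega)
  rw [hm] at hm1
  obtain ⟨v, hv, hv0⟩ := (Submodule.ne_bot_iff _).1 hm0
  have hev : ⁅e, v⁆ = 0 := by
    have := lie_mem_rootSubspace he hv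
    rwa [add_comm, add_assoc, ← succ_nsmul, hm1, Submodule.mem_bot] at this
  obtain ⟨k, hk, hki⟩ := hH.exists_rootSubspace_eq_bot (neg_ne_zero.2 hα)
    (hH.rootSubspace_neg_ne_bot hα hα') hm0
  refine rootSubspace_sub_ne_bot hf hv hv0 hev hh (fun k => (k + 1) * β h) (by simp [hαh])
    (fun k => by push_cast; simp [hαh]; ring) (fun j hj => ?_) hk
  exact mul_ne_zero (by exact_mod_cast hki (j + 1) (by omega) (by omega)) hβh

/-- The lowering operator `f` is injective on `L_α`. A nonzero `x` in its kernel would be a lowest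
weight vector of weight `α` for an `sl₂`-triple, and raising it would make every multiple of `α`
a root. -/
theorem eq_zero_of_lie_eq_zero [FiniteDimensional F L] (h2 : (2 : F) ≠ 0)
    (hcen : LieAlgebra.center F L = ⊥)
    {α : Module.Dual F H} (hα : α ≠ 0) (hα' : rootSubspace H α ≠ ⊥)
    {e f : L} (he : e ∈ rootSubspace H α) (hf : f ∈ rootSubspace H (-α)) (hef : ⁅e, f⁆ ≠ 0)
    {x : L} (hx : x ∈ rootSubspace H α) (hfx : ⁅f, x⁆ = 0) : x = 0 := by
  by_contra hx0
  have hmem : ⁅e, f⁆ ∈ H := by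
    rw [← hH.mem_rootSubspace_zero, ← add_neg_cancel α]
    exact lie_mem_rootSubspace he hf
  obtain ⟨h, hh⟩ : ∃ h : H, ⁅e, f⁆ = h := ⟨⟨_, hmem⟩, rfl⟩
  have hαh := hH.apply_lie_ne_zero hcen hα hα' he hf hh (by rintro rfl; exact hef hh)
  obtain ⟨k, hk, hki⟩ := hH.exists_rootSubspace_eq_bot hα hα' hα'
  -- The first gap above `α` is not at a multiple of `α` equal to `0`, since `0` is a root.
  have hk1 : ((k + 1 : ℕ) : F) ≠ 0 := by
    intro hk1
    rw [add_comm, ← succ_nsmul, ← Nat.cast_smul_eq_nsmul F, hk1, zero_smul] at hk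
    have := hH.mem_rootSubspace_zero.2 hmem
    rw [hk, Submodule.mem_bot] at this
    exact hef this
  refine rootSubspace_sub_ne_bot (α := -α) (h := -h) (f := e) (n := k) (by rwa [neg_neg]) hx hx0 hfx
    (by rw [← lie_skew, hh]; rfl) (fun k => -(α h) * ((k + 1) * (k + 2) / 2)) ?_ ?_ ?_ ?_
  · simp [h2]
  · intro k
    simp
    field_simp
    ring
  · intro j hj
    refine mul_ne_zero (neg_ne_zero.2 hαh) (div_ne_zero (mul_ne_zero ?_ ?_) h2)
    · exact_mod_cast hki (j + 1) (by omega) (by omega)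
    · rcases Nat.lt_or_ge (j + 1) k with h | h
      · exact_mod_cast hki (j + 2) (by omega) (by omega)
      · obtain rfl : j + 1 = k := by omega
        exact_mod_cast hk1
  · rwa [neg_neg]

/-- The root spaces of nonzero roots are one-dimensional. -/
theorem exists_eq_smul [FiniteDimensional F L] (h2 : (2 : F) ≠ 0)
    (hcen : LieAlgebra.center F L = ⊥)
    {α : Module.Dual F H} (hα : α ≠ 0) {x y : L} (hx : x ∈ rootSubspace H α) (hx0 : x ≠ 0)
    (hy : y ∈ rootSubspace H α) : ∃ c : F, y = c • x := by
  have hα' : rootSubspace H α ≠ ⊥ := (Submodule.ne_bot_iff _).2 ⟨x, hx, hx0⟩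
  obtain ⟨e, he, f, hf, hef⟩ := hH.exists_lie_ne_zero hα hα'
  set S := Submodule.span F
      {z : L | ∃ x ∈ rootSubspace H α, ∃ y ∈ rootSubspace H (-α), ⁅x, y⁆ = z} with hS
  have hmem : ∀ z ∈ rootSubspace H α, ⁅z, f⁆ ∈ S := fun z hz =>
    Submodule.subset_span ⟨z, hz, f, hf, rfl⟩
  have hinj : ∀ z ∈ rootSubspace H α, ⁅z, f⁆ = 0 → z = 0 := fun z hz h0 =>
    hH.eq_zero_of_lie_eq_zero h2 hcen hα hα' he hf hef hz (by rw [← lie_skew, h0, neg_zero])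
  have hne : (⟨⁅x, f⁆, hmem x hx⟩ : S) ≠ 0 := fun h =>
    hx0 (hinj x hx (congrArg Subtype.val h))
  obtain ⟨c, hc⟩ := (finrank_eq_one_iff_of_nonzero' _ hne).1 (hH.finrank_coroot α hα hα')
    ⟨⁅y, f⁆, hmem y hy⟩
  refine ⟨c, sub_eq_zero.1 (hinj _ (sub_mem hy (Submodule.smul_mem _ c hx)) ?_)⟩
  have hc := congrArg Subtype.val hc
  simp only [SetLike.val_smul] at hc
  rw [sub_lie, smul_lie, hc, sub_self]

/-- The projections onto the summands of the root space decomposition. -/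
theorem exists_projections :
    ∃ p : Module.Dual F H → L →ₗ[F] L, (∀ α x, p α x ∈ rootSubspace H α) ∧
      (∀ α, ∀ x ∈ rootSubspace H α, p α x = x) ∧
      (∀ α β, α ≠ β → ∀ x ∈ rootSubspace H β, p α x = 0) := by
  classical
  have hint := DirectSum.isInternal_submodule_of_iSupIndep_of_iSup_eq_top
    hH.iSupIndep_rootSubspace hH.iSup_eq_top
  let := hint.chooseDecomposition
  refine ⟨fun α => (rootSubspace H α).subtype ∘ₗ
    DirectSum.component F _ (fun α => rootSubspace H α) α ∘ₗ
    (DirectSum.decomposeLinearEquiv (rootSubspace H)).toLinearMap, fun α x => ?_,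
    fun α x hx => ?_, fun α β hαβ x hx => ?_⟩
  · exact Subtype.property _
  · exact DirectSum.decompose_of_mem_same _ hx
  · exact DirectSum.decompose_of_mem_ne _ hx hαβ.symm

/-- Every derivation agrees on `H` with an inner one. The restriction of `D` to `H` is a cocycle;
its component at a root `α ≠ 0` is `h ↦ α h • p α (D t)` for any `t` with `α t = 1`, which is a
coboundary. -/
theorem exists_derivation_apply_eq_lie [FiniteDimensional F L]
    (hcen : LieAlgebra.center F L = ⊥) (D : LieDerivation F L L) :
    ∃ u : L, ∀ h ∈ H, D h = ⁅u, h⁆ := by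
  classical
  have habel := hH.abelian
  have hHH : ∀ h h' : H, ⁅(h : L), (h' : L)⁆ = 0 := fun h h' =>
    congrArg Subtype.val (trivial_lie_zero H H h h')
  obtain ⟨p, hp, hp_same, hp_ne⟩ := hH.exists_projections
  have hp_lie : ∀ (α : Module.Dual F H) (h : H) x, p α ⁅(h : L), x⁆ = α h • p α x := by
    intro α h
    refine hH.induction_on (fun β x hx => ?_) (by simp) fun x y hx hy => ?_
    · rw [mem_rootSubspace.1 hx, map_smul]
      by_cases hαβ : α = β
      · rw [hαβ]
      · rw [hp_ne α β hαβ x hx, smul_zero, smul_zero]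
    · rw [lie_add, map_add, map_add, hx, hy, smul_add]
  have hp_zero : ∀ x, (∀ α, α ≠ 0 → p α x = 0) → x ∈ H := by
    intro x hx
    suffices x = p 0 x by rw [this, ← hH.mem_rootSubspace_zero]; exact hp 0 x
    have key : ∀ x, x = ∑ α ∈ hH.finite_roots.toFinset, p α x := by
      refine hH.induction_on (fun β x hx => ?_) (by simp) fun x y hx hy => ?_
      · by_cases hx0 : x = 0
        · simp [hx0]
        rw [Finset.sum_eq_single β, hp_same β x hx]
        · exact fun α _ hα => hp_ne α β hα x hx
        · intro hβ
          refine absurd ?_ hβ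
          rw [Set.Finite.mem_toFinset, Set.mem_ofPred, Submodule.ne_bot_iff]
          exact ⟨x, hx, hx0⟩
      · simp only [map_add, Finset.sum_add_distrib]
        rw [← hx, ← hy]
    nth_rw 1 [key x]
    refine Finset.sum_eq_single 0 (fun α _ hα => hx α hα) fun h0 => ?_
    have : rootSubspace H 0 = ⊥ := by simpa using h0
    have h := hp 0 x
    rwa [this, Submodule.mem_bot] at h
  have hnorm : ∀ α : Module.Dual F H, ∃ h : H, α ≠ 0 → α h = 1 := by
    intro α
    by_cases hα : α = 0
    · exact ⟨0, fun h => absurd hα h⟩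
    · obtain ⟨h, hh⟩ := DFunLike.ne_iff.1 hα
      exact ⟨(α h)⁻¹ • h, fun _ => by rw [map_smul, smul_eq_mul, inv_mul_cancel₀ hh]⟩
  choose t ht using hnorm
  have hcocycle : ∀ α : Module.Dual F H, α ≠ 0 → ∀ h : H,
      p α (D h) = α h • p α (D (t α)) := by
    intro α hα h
    have h1 : ⁅(t α : L), D h⁆ = ⁅(h : L), D (t α)⁆ := by
      have := D.apply_lie_eq_sub (h : L) (t α : L)
      rw [hHH, map_zero] at this
      exact (sub_eq_zero.1 this.symm).symm
    have h2 := congrArg (p α) h1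
    rwa [hp_lie, hp_lie, ht α hα, one_smul] at h2
  set R := hH.finite_roots.toFinset.erase 0
  set u : L := -∑ α ∈ R, p α (D (t α)) with hu
  have hD' : ∀ h : H, D h - ⁅u, (h : L)⁆ ∈ H := by
    intro h
    refine hp_zero _ fun γ hγ => ?_
    rw [← lie_skew u (h : L), sub_neg_eq_add, map_add, hp_lie, hu, map_neg, map_sum]
    have : ∑ α ∈ R, p γ (p α (D (t α))) = p γ (D (t γ)) := by
      rw [Finset.sum_eq_single γ]
      · exact hp_same _ _ (hp _ _)
      · exact fun α _ hα => hp_ne γ α hα.symm _ (hp _ _)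
      · intro hR
        have : rootSubspace H γ = ⊥ := by simpa [R, hγ] using hR
        have h := hp γ (D (t γ))
        rw [this, Submodule.mem_bot] at h
        rw [h, map_zero]
    rw [this, hcocycle γ hγ, smul_neg, add_neg_cancel]
  refine ⟨u, fun h hh => ?_⟩
  -- `D - ad u` maps `H` into `H`. As `D - ad u` is a derivation, comparing the components at `β` of
  -- its values on `⁅h, x⁆` for `x` of weight `β` shows that its values on `H` are central.
  suffices D h - ⁅u, h⁆ ∈ LieAlgebra.center F L by
    rwa [hcen, LieSubmodule.mem_bot, sub_eq_zero] at this
  rw [LieModule.mem_maxTrivSubmodule]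
  refine hH.induction_on (fun β x hx => ?_) (zero_lie _) fun x y hx hy => ?_
  · let D' : LieDerivation F L L := D - LieDerivation.ad F L u
    have h1 := congrArg (p β) (D'.apply_lie_eq_add h x)
    have h2 : D' h = D h - ⁅u, h⁆ := by simp [D']
    rw [mem_rootSubspace.1 hx ⟨h, hh⟩, map_smul, map_smul, map_add, hp_lie β ⟨h, hh⟩, h2,
      mem_rootSubspace.1 hx ⟨_, hD' ⟨h, hh⟩⟩, map_smul, hp_same β x hx, left_eq_add] at h1
    rw [← lie_skew, mem_rootSubspace.1 hx ⟨_, hD' ⟨h, hh⟩⟩, h1, neg_zero]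
  · rw [add_lie, hx, hy, add_zero]

omit hH in
theorem apply_mem_rootSubspace (D : LieDerivation F L L) (hD : ∀ h ∈ H, D h = 0)
    {α : Module.Dual F H} {x : L} (hx : x ∈ rootSubspace H α) : D x ∈ rootSubspace H α := by
  rw [mem_rootSubspace] at *
  intro h
  have := D.apply_lie_eq_add (h : L) x
  rwa [hx, map_smul, hD _ h.2, zero_lie, add_zero, eq_comm] at this

/-- Derivations that kill `H` act on each one-dimensional root space by a scalar, so they
commute. -/
theorem commute_of_apply_eq_zero [FiniteDimensional F L] (h2 : (2 : F) ≠ 0)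
    (hcen : LieAlgebra.center F L = ⊥) (D₁ D₂ : LieDerivation F L L)
    (hD₁ : ∀ h ∈ H, D₁ h = 0) (hD₂ : ∀ h ∈ H, D₂ h = 0) (x : L) : D₁ (D₂ x) = D₂ (D₁ x) := by
  refine hH.induction_on (P := fun x => D₁ (D₂ x) = D₂ (D₁ x)) (fun α x hx => ?_) (by simp)
    (fun x y hx hy => by rw [map_add, map_add, map_add, map_add, hx, hy]) x
  by_cases hα : α = 0
  · rw [hα, hH.mem_rootSubspace_zero] at hx
    rw [hD₁ x hx, hD₂ x hx, map_zero, map_zero]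
  by_cases hx0 : x = 0
  · simp [hx0]
  obtain ⟨c₁, hc₁⟩ := hH.exists_eq_smul h2 hcen hα hx hx0 (apply_mem_rootSubspace D₁ hD₁ hx)
  obtain ⟨c₂, hc₂⟩ := hH.exists_eq_smul h2 hcen hα hx hx0 (apply_mem_rootSubspace D₂ hD₂ hx)
  rw [hc₁, hc₂, map_smul, map_smul, hc₁, hc₂, smul_comm]

/-- The commutator of two derivations is inner. -/
theorem exists_derivation_lie_eq_lie [FiniteDimensional F L] (h2 : (2 : F) ≠ 0)
    (hcen : LieAlgebra.center F L = ⊥) (D₁ D₂ : LieDerivation F L L) :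
    ∃ u : L, ∀ y, ⁅D₁, D₂⁆ y = ⁅u, y⁆ := by
  obtain ⟨u₁, hu₁⟩ := hH.exists_derivation_apply_eq_lie hcen D₁
  obtain ⟨u₂, hu₂⟩ := hH.exists_derivation_apply_eq_lie hcen D₂
  have hcomm := hH.commute_of_apply_eq_zero h2 hcen
    (D₁ - LieDerivation.ad F L u₁) (D₂ - LieDerivation.ad F L u₂)
    (fun h hh => by simp [hu₁ h hh]) (fun h hh => by simp [hu₂ h hh])
  refine ⟨D₁ u₂ - D₂ u₁ - ⁅u₁, u₂⁆, fun y => ?_⟩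
  have hy := hcomm y
  simp only [LieDerivation.sub_apply, LieDerivation.ad_apply_apply, map_sub,
    LieDerivation.apply_lie_eq_add, lie_sub, sub_lie, lie_lie] at hy
  rw [LieDerivation.lie_apply, sub_lie, sub_lie, lie_lie]
  linear_combination (norm := module) hy

end IsClassicalCartan

end ClassicalCartan

/-! ### Simplicity and derivations of the Witt algebra -/

section WittAlgebra

open MvPolynomial

variable {F : Type*} [Field F] {n : ℕ}

namespace WittPlus

/-! The additive structure on derivations of a polynomial ring is reached through semirings, while
that of the Lie ring goes through rings. The two agree by `rfl` only after unfolding more than `rw`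
does, so the basic Lie identities are restated here for use in rewriting. -/

variable (u v w : WittPlus F n)

theorem zero_lie : ⁅(0 : WittPlus F n), w⁆ = 0 := _root_.zero_lie w

theorem lie_zero : ⁅w, (0 : WittPlus F n)⁆ = 0 := _root_.lie_zero w

theorem neg_lie : ⁅-v, w⁆ = -⁅v, w⁆ := _root_.neg_lie v w

theorem lie_neg : ⁅v, -w⁆ = -⁅v, w⁆ := _root_.lie_neg v w

theorem lie_skew : -⁅w, v⁆ = ⁅v, w⁆ := _root_.lie_skew v w

theorem add_lie : ⁅u + v, w⁆ = ⁅u, w⁆ + ⁅v, w⁆ := _root_.add_lie u v w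

theorem lie_add : ⁅u, v + w⁆ = ⁅u, v⁆ + ⁅u, w⁆ := _root_.lie_add u v w

theorem lie_smul (c : F) : ⁅v, c • w⁆ = c • ⁅v, w⁆ := _root_.lie_smul c v w

theorem lie_sum {ι : Type*} (s : Finset ι) (f : ι → WittPlus F n) :
    ⁅u, ∑ i ∈ s, f i⁆ = ∑ i ∈ s, ⁅u, f i⁆ := _root_.lie_sum s f u

theorem leibniz_lie : ⁅u, ⁅v, w⁆⁆ = ⁅⁅u, v⁆, w⁆ + ⁅v, ⁅u, w⁆⁆ := LieRing.leibniz_lie u v w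


theorem lie_polynomial_smul (D w : WittPlus F n) (f : MvPolynomial (Fin n) F) :
    ⁅D, f • w⁆ = D f • w + f • ⁅D, w⁆ := by
  ext i
  simp only [Derivation.commutator_apply, Derivation.add_apply, Derivation.smul_apply, smul_eq_mul,
    Derivation.leibniz]
  ring_nf

theorem lie_pderiv_apply_X (w : WittPlus F n) (i k : Fin n) :
    ⁅(pderiv i : WittPlus F n), w⁆ (X k) = pderiv i (w (X k)) := by
  classical
  rw [Derivation.commutator_apply, pderiv_X]
  by_cases h : i = k
  · subst h; simp
  · simp [Ne.symm h]

theorem pderiv_lie_pderiv (i j : Fin n) :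
    ⁅(pderiv i : WittPlus F n), (pderiv j : WittPlus F n)⁆ = 0 := by
  classical
  refine MvPolynomial.derivation_ext fun k => ?_
  rw [lie_pderiv_apply_X, pderiv_X, Derivation.zero_apply]
  by_cases h : j = k
  · subst h; simp
  · simp [Ne.symm h]

theorem eq_sum_smul_pderiv (w : WittPlus F n) :
    w = ∑ k, w (X k) • (pderiv k : WittPlus F n) := by
  classical
  refine MvPolynomial.derivation_ext fun k => ?_
  rw [← Derivation.coeFnAddMonoidHom_apply (∑ k, w (X k) • (pderiv k : WittPlus F n)),
    map_sum, Finset.sum_apply]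
  simp [Pi.single_apply, pderiv_X]

@[elab_as_elim]
theorem induction {P : WittPlus F n → Prop}
    (hmono : ∀ (a : Fin n →₀ ℕ) (r : F) (k : Fin n),
      P (monomial a r • (pderiv k : WittPlus F n)))
    (hzero : P 0) (hadd : ∀ v w, P v → P w → P (v + w)) (w : WittPlus F n) : P w := by
  rw [eq_sum_smul_pderiv w]
  refine Finset.sum_induction _ P (fun v w => hadd v w) hzero fun k _ => ?_
  induction w (X k) using MvPolynomial.induction_on' with
  | monomial a r => exact hmono a r k
  | add p q hp hq =>
    rw [add_smul]
    exact hadd _ _ hp hq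

/-- The Euler vector field `∑ tᵢ ∂ᵢ`, whose adjoint action grades the Witt algebra. -/
noncomputable def eulerField (F : Type*) [Field F] (n : ℕ) : WittPlus F n :=
  ∑ i, (X i : MvPolynomial (Fin n) F) • (pderiv i : WittPlus F n)

theorem eulerField_apply (f : MvPolynomial (Fin n) F) :
    eulerField F n f = ∑ i, X i * pderiv i f := by
  rw [eulerField, ← Derivation.coeFnAddMonoidHom_apply, map_sum, Finset.sum_apply]
  simp

theorem eulerField_monomial (a : Fin n →₀ ℕ) (r : F) :
    eulerField F n (monomial a r) = (a.degree : F) • monomial a r := by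
  rw [eulerField_apply]
  simp only [X_mul_pderiv_monomial]
  rw [← Finset.sum_smul, Nat.cast_smul_eq_nsmul, Finsupp.degree_eq_sum]

theorem eulerField_X (i : Fin n) : eulerField F n (X i) = X i := by
  have := eulerField_monomial (F := F) (Finsupp.single i 1) 1
  simpa [X] using this

theorem coeff_eulerField (f : MvPolynomial (Fin n) F) (a : Fin n →₀ ℕ) :
    coeff a (eulerField F n f) = a.degree * coeff a f := by
  classical
  induction f using MvPolynomial.induction_on' with
  | monomial b r =>
    rw [eulerField_monomial, coeff_smul, coeff_monomial, smul_eq_mul]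
    split_ifs with h
    · rw [h]
    · simp
  | add p q hp hq => rw [map_add, coeff_add, coeff_add, hp, hq, mul_add]

theorem eulerField_lie_apply_X (w : WittPlus F n) (k : Fin n) :
    ⁅eulerField F n, w⁆ (X k) = eulerField F n (w (X k)) - w (X k) := by
  rw [Derivation.commutator_apply, eulerField_X]

theorem eulerField_lie_pderiv (i : Fin n) :
    ⁅eulerField F n, (pderiv i : WittPlus F n)⁆ = -(pderiv i : WittPlus F n) := by
  classical
  refine MvPolynomial.derivation_ext fun k => ?_
  rw [eulerField_lie_apply_X, pderiv_X, Derivation.neg_apply, pderiv_X]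
  by_cases h : i = k
  · subst h; simp
  · simp [Ne.symm h]

theorem eulerField_lie_monomial (a : Fin n →₀ ℕ) (r : F) (k : Fin n) :
    ⁅eulerField F n, monomial a r • (pderiv k : WittPlus F n)⁆ =
      ((a.degree : F) - 1) • (monomial a r • (pderiv k : WittPlus F n)) := by
  rw [lie_polynomial_smul, eulerField_lie_pderiv, eulerField_monomial, smul_neg, smul_assoc]
  module

/-- A vector field commuting with all `∂ᵢ` has constant coefficients, so it has degree `-1`. -/
theorem eulerField_lie_of_commute {w : WittPlus F n}
    (hw : ∀ i, ⁅(pderiv i : WittPlus F n), w⁆ = 0) : ⁅eulerField F n, w⁆ = -w := by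
  refine MvPolynomial.derivation_ext fun k => ?_
  rw [eulerField_lie_apply_X, eulerField_apply, Derivation.neg_apply, sub_eq_neg_self]
  refine Finset.sum_eq_zero fun i _ => ?_
  rw [← lie_pderiv_apply_X, hw, Derivation.zero_apply, mul_zero]

theorem eq_zero_of_commute {w : WittPlus F n}
    (hw : ∀ i, ⁅(pderiv i : WittPlus F n), w⁆ = 0) (hE : ⁅eulerField F n, w⁆ = 0) : w = 0 := by
  rw [← neg_eq_zero, ← eulerField_lie_of_commute hw, hE]

/-- The degree zero part of a vector field is what remains of it modulo the image of `ad E`, where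
`E` is the Euler field. -/
theorem exists_eulerField_lie_sub_eq_zero (w : WittPlus F n) :
    ∃ u : WittPlus F n, ⁅eulerField F n, w - ⁅u, eulerField F n⁆⁆ = 0 := by
  induction w using WittPlus.induction with
  | hmono a r k =>
    by_cases h : ((a.degree : F) - 1) = 0
    · exact ⟨0, by rw [zero_lie, sub_zero, eulerField_lie_monomial, h, zero_smul]⟩
    · refine ⟨-((a.degree : F) - 1)⁻¹ • (monomial a r • (pderiv k : WittPlus F n)), ?_⟩
      rw [← lie_skew (_ • _) (eulerField F n), lie_smul, eulerField_lie_monomial,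
        smul_smul, neg_mul, inv_mul_cancel₀ h]
      convert lie_zero (eulerField F n)
      module
  | hzero => exact ⟨0, by rw [zero_lie, sub_zero, lie_zero]⟩
  | hadd v w hv hw =>
    obtain ⟨u₁, h₁⟩ := hv
    obtain ⟨u₂, h₂⟩ := hw
    refine ⟨u₁ + u₂, ?_⟩
    rw [add_lie, add_sub_add_comm, lie_add, h₁, h₂, add_zero]

/-- A nonzero ideal contains a nonzero vector field with constant coefficients: bracketing with the
`∂ᵢ` lowers the degree of the coefficients. -/
theorem exists_mem_commute (I : LieIdeal F (WittPlus F n)) (N : ℕ) :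
    ∀ x ∈ I, x ≠ 0 → (∀ (k : Fin n) (a : Fin n →₀ ℕ), N ≤ a.degree → coeff a (x (X k)) = 0) →
      ∃ v ∈ I, v ≠ 0 ∧ ∀ i, ⁅(pderiv i : WittPlus F n), v⁆ = 0 := by
  induction N with
  | zero =>
    intro x _ hx0 hx
    refine absurd (MvPolynomial.derivation_ext fun k => ?_) hx0
    ext a
    simpa using hx k a (Nat.zero_le _)
  | succ N ih =>
    intro x hxI hx0 hx
    by_cases h : ∀ i, ⁅(pderiv i : WittPlus F n), x⁆ = 0
    · exact ⟨x, hxI, hx0, h⟩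
    · push Not at h
      obtain ⟨i, hi⟩ := h
      refine ih _ (lie_mem_right F _ I _ _ hxI) hi fun k a ha => ?_
      rw [lie_pderiv_apply_X, coeff_pderiv, hx, zero_mul]
      rw [map_add, Finsupp.degree_single]
      omega

variable [CharZero F]

theorem eq_C_of_eulerField_eq_zero {f : MvPolynomial (Fin n) F} (hf : eulerField F n f = 0) :
    f = C (coeff 0 f) := by
  classical
  ext a
  rw [coeff_C]
  split_ifs with h
  · rw [h]
  · have := coeff_eulerField f a
    rw [hf, coeff_zero, eq_comm, mul_eq_zero, Nat.cast_eq_zero, Finsupp.degree_eq_zero_iff] at this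
    exact this.resolve_left (Ne.symm h)

/-- A vector field of degree `-1` has constant coefficients. -/
theorem commute_of_eulerField_lie {w : WittPlus F n} (hw : ⁅eulerField F n, w⁆ = -w) (i : Fin n) :
    ⁅(pderiv i : WittPlus F n), w⁆ = 0 := by
  refine MvPolynomial.derivation_ext fun k => ?_
  have h := eulerField_lie_apply_X w k
  rw [hw, Derivation.neg_apply, eq_comm, sub_eq_neg_self] at h
  rw [lie_pderiv_apply_X, eq_C_of_eulerField_eq_zero h, pderiv_C, Derivation.zero_apply]

/-- The operator `ad E + 1` is semisimple: its kernel meets its range in `0`. -/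
theorem eq_zero_of_eulerField_lie_add {y z : WittPlus F n} (hy : ⁅eulerField F n, y⁆ + y = z)
    (hz : ⁅eulerField F n, z⁆ = -z) : z = 0 := by
  refine MvPolynomial.derivation_ext fun k => ?_
  have h1 := eulerField_lie_apply_X z k
  rw [hz, Derivation.neg_apply, eq_comm, sub_eq_neg_self] at h1
  have h2 : eulerField F n (y (X k)) = z (X k) := by
    rw [← hy, Derivation.add_apply, eulerField_lie_apply_X, sub_add_cancel]
  rw [eq_C_of_eulerField_eq_zero h1, ← h2, coeff_eulerField]
  simp

/-- A derivation `D` killing the Euler field and all `∂ᵢ` is zero. By induction on the degree of a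
monomial vector field `w`, the value `D w` commutes with the `∂ᵢ`, hence has degree `-1`; but `D`
preserves degrees. -/
theorem derivation_eq_zero_of_apply_eq_zero (D : LieDerivation F (WittPlus F n) (WittPlus F n))
    (hE : D (eulerField F n) = 0) (hD : ∀ i, D (pderiv i : WittPlus F n) = 0) (w : WittPlus F n) :
    D w = 0 := by
  suffices ∀ (d : ℕ) (a : Fin n →₀ ℕ), a.degree = d → ∀ (r : F) (k : Fin n),
      D ((monomial a r : MvPolynomial (Fin n) F) • (pderiv k : WittPlus F n)) = 0 by
    induction w using WittPlus.induction with
    | hmono a r k => exact this _ a rfl r k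
    | hzero => exact map_zero D
    | hadd v w hv hw => rw [map_add, hv, hw, add_zero]
  intro d
  induction d with
  | zero =>
    intro a ha r k
    obtain rfl := (Finsupp.degree_eq_zero_iff _).1 ha
    have : (monomial 0 r : MvPolynomial (Fin n) F) • (pderiv k : WittPlus F n) =
        r • (pderiv k : WittPlus F n) := by
      rw [← C_apply, ← algebraMap_eq, algebraMap_smul]
    rw [this, map_smul, hD, smul_zero]
  | succ d ih =>
    intro a ha r k
    have hcomm : ∀ i, ⁅(pderiv i : WittPlus F n),
        D (monomial a r • (pderiv k : WittPlus F n))⁆ = 0 := by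
      intro i
      have h := D.apply_lie_eq_add (pderiv i : WittPlus F n)
        (monomial a r • (pderiv k : WittPlus F n))
      rw [hD, zero_lie, add_zero] at h
      rw [← h, lie_polynomial_smul, pderiv_lie_pderiv, smul_zero, add_zero, pderiv_monomial]
      by_cases hai : a i = 0
      · simp [hai]
      · refine ih _ ?_ _ _
        have hle : Finsupp.single i 1 ≤ a := by
          rw [Finsupp.single_le_iff]; omega
        have := congrArg Finsupp.degree (tsub_add_cancel_of_le hle)
        rw [map_add, ha, Finsupp.degree_single] at this
        omega
    have h1 := eulerField_lie_of_commute hcomm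
    have h2 := D.apply_lie_eq_add (eulerField F n) (monomial a r • (pderiv k : WittPlus F n))
    rw [hE, zero_lie, add_zero, h1, eulerField_lie_monomial, map_smul, ha] at h2
    have h3 : ((d + 1 : ℕ) : F) •
        D ((monomial a r : MvPolynomial (Fin n) F) • (pderiv k : WittPlus F n)) = 0 := by
      linear_combination (norm := module) h2
    exact (smul_eq_zero.1 h3).resolve_left (by exact_mod_cast d.succ_ne_zero)

/-- Every derivation `D` of the Witt algebra is inner. Subtracting inner derivations makes `D E` of
degree zero for the Euler field `E`, hence zero; then `D ∂ᵢ` has constant coefficients and is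
removed by a linear vector field. -/
theorem exists_derivation_eq_lie
    (D : LieDerivation F (WittPlus F n) (WittPlus F n)) :
    ∃ u : WittPlus F n, ∀ w, D w = ⁅u, w⁆ := by
  set E := eulerField F n with hEdef
  obtain ⟨u, hu⟩ := exists_eulerField_lie_sub_eq_zero (D E)
  let D₁ := D - LieDerivation.ad F _ u
  have hD₁ : ∀ w, D₁ w = D w - ⁅u, w⁆ := fun w => by simp [D₁]
  rw [← hEdef, ← hD₁] at hu
  have hcomm : ∀ i, ⁅(pderiv i : WittPlus F n), D₁ E⁆ = 0 := by
    intro i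
    refine eq_zero_of_eulerField_lie_add (y := D₁ (pderiv i : WittPlus F n)) ?_ ?_
    · have h := D₁.apply_lie_eq_add E (pderiv i : WittPlus F n)
      rw [hEdef, eulerField_lie_pderiv, map_neg, ← hEdef, ← lie_skew (D₁ E)] at h
      linear_combination (norm := module) -h
    · rw [leibniz_lie, hu, lie_zero, add_zero, eulerField_lie_pderiv, neg_lie]
  have hE₁ : D₁ E = 0 := eq_zero_of_commute hcomm hu
  have hy : ∀ i, ⁅E, D₁ (pderiv i : WittPlus F n)⁆ = -D₁ (pderiv i : WittPlus F n) := by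
    intro i
    have h := D₁.apply_lie_eq_add E (pderiv i : WittPlus F n)
    rw [hE₁, zero_lie, add_zero, hEdef, eulerField_lie_pderiv, map_neg] at h
    exact h.symm
  -- `v` has degree zero and the same brackets with the `∂ⱼ` as `D₁`.
  set v : WittPlus F n := -∑ i, (X i : MvPolynomial (Fin n) F) • D₁ (pderiv i : WittPlus F n)
    with hv
  have hvE : ⁅v, E⁆ = 0 := by
    rw [← lie_skew, hv, lie_neg, neg_neg, lie_sum]
    refine Finset.sum_eq_zero fun i _ => ?_
    rw [lie_polynomial_smul, hy, hEdef, eulerField_X, smul_neg, add_neg_cancel]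
  have hvi : ∀ j, ⁅v, (pderiv j : WittPlus F n)⁆ = D₁ (pderiv j : WittPlus F n) := by
    classical
    intro j
    rw [← lie_skew, hv, lie_neg, neg_neg, lie_sum, Finset.sum_eq_single j]
    · rw [lie_polynomial_smul, commute_of_eulerField_lie (hy _), smul_zero, add_zero, pderiv_X_self,
        one_smul]
    · intro i _ hij
      rw [lie_polynomial_smul, commute_of_eulerField_lie (hy _), smul_zero, add_zero,
        pderiv_X_of_ne hij, zero_smul]
    · simp
  refine ⟨u + v, fun w => ?_⟩
  have := derivation_eq_zero_of_apply_eq_zero (D₁ - LieDerivation.ad F _ v)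
    (by rw [← hEdef]; simp [hE₁, hvE]) (fun i => by simp [hvi]) w
  rw [LieDerivation.sub_apply, hD₁, LieDerivation.ad_apply_apply] at this
  rw [add_lie]
  linear_combination (norm := module) this

theorem isSimple (hn : 1 ≤ n) : LieAlgebra.IsSimple F (WittPlus F n) where
  eq_bot_or_eq_top I := by
    classical
    refine or_iff_not_imp_left.2 fun hI => ?_
    obtain ⟨x, hxI, hx0⟩ : ∃ x ∈ I, x ≠ 0 := by
      rw [LieSubmodule.eq_bot_iff] at hI
      push Not at hI
      exact hI
    obtain ⟨v, hvI, hv0, hv⟩ := exists_mem_commute I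
      (Finset.univ.sup (fun k => (x (X k)).totalDegree) + 1) x hxI hx0 fun k a ha => by
        refine coeff_eq_zero_of_totalDegree_lt ?_
        have : (x (X k)).totalDegree ≤ Finset.univ.sup (fun k => (x (X k)).totalDegree) :=
          Finset.le_sup (f := fun k => (x (X k)).totalDegree) (Finset.mem_univ k)
        have h2 : a.degree = ∑ i ∈ a.support, a i := rfl
        omega
    obtain ⟨k, hk⟩ : ∃ k, v (X k) ≠ 0 := by
      by_contra! h
      exact hv0 (MvPolynomial.derivation_ext fun k => by simp [h])
    obtain ⟨c, hc⟩ : ∃ c, v (X k) = C c := by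
      refine ⟨_, eq_C_of_eulerField_eq_zero ?_⟩
      have := eulerField_lie_apply_X v k
      rwa [eulerField_lie_of_commute hv, Derivation.neg_apply, eq_comm, sub_eq_neg_self] at this
    have hc0 : c ≠ 0 := by rintro rfl; simp [hc] at hk
    have hpd : ∀ j, (pderiv j : WittPlus F n) ∈ I := by
      intro j
      have h := lie_mem_left F _ I v ((X k : MvPolynomial (Fin n) F) • (pderiv j : WittPlus F n))
        hvI
      rw [lie_polynomial_smul, ← lie_skew v, hv, neg_zero, smul_zero, add_zero, hc, ← algebraMap_eq,
        algebraMap_smul] at h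
      simpa [smul_smul, hc0] using I.smul_mem c⁻¹ h
    rw [eq_top_iff]
    intro w _
    induction w using WittPlus.induction with
    | hmono a r k =>
      -- In characteristic zero `∂ⱼ` is surjective on polynomials.
      let j : Fin n := ⟨0, hn⟩
      have h := lie_mem_left F _ I (pderiv j : WittPlus F n)
        (monomial (a + Finsupp.single j 1) (r / (a j + 1)) • (pderiv k : WittPlus F n)) (hpd j)
      rw [lie_polynomial_smul, pderiv_lie_pderiv, smul_zero, add_zero, pderiv_monomial,
        add_tsub_cancel_right] at h
      convert h using 3
      have : (a j + 1 : F) ≠ 0 := by exact_mod_cast (a j).succ_ne_zero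
      simp
      field_simp
    | hzero => exact I.zero_mem
    | hadd v w hv hw => exact I.add_mem (hv trivial) (hw trivial)
  non_abelian h := by
    let j : Fin n := ⟨0, hn⟩
    have h1 := trivial_lie_zero _ _ (pderiv j : WittPlus F n)
      ((X j : MvPolynomial (Fin n) F) • (pderiv j : WittPlus F n))
    rw [lie_polynomial_smul, pderiv_lie_pderiv, smul_zero, add_zero, pderiv_X_self,
      one_smul] at h1
    have h2 := Derivation.congr_fun h1 (X j)
    rw [pderiv_X_self] at h2
    exact one_ne_zero h2

end WittPlus

end WittAlgebra

/-! ### Triviality of commutative post-Lie structures -/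

theorem theorem5p3 :
    (∀ (F : Type u) (L : Type v) [Field F] [LieRing L] [LieAlgebra F L] [FiniteDimensional F L],
      ringChar F ≠ 2 → ringChar F ≠ 3 → LieAlgebra.IsSimple F L →
      (IsClassicalLie F L ∨ LieAlgebra.IsKilling F L) →
      ∀ mul : L →ₗ[F] L →ₗ[F] L, IsCommPostLie F L mul → ∀ x y : L, mul x y = 0) ∧
    (∀ (F : Type u) [Field F] [CharZero F] (n : ℕ), 1 ≤ n →
      ∀ mul : WittPlus F n →ₗ[F] WittPlus F n →ₗ[F] WittPlus F n,
      IsCommPostLie F (WittPlus F n) mul → ∀ x y : WittPlus F n, mul x y = 0) := by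
  refine ⟨fun F L _ _ _ _ hF _ hL hcases mul h => ?_, fun F _ _ n hn mul h => ?_⟩
  · have h2 : (2 : F) ≠ 0 := Ring.two_ne_zero hF
    refine mul_eq_zero_of_derivation_lie_inner h2 (fun D₁ D₂ => ?_) h
    rcases hcases with hcl | hK
    · obtain ⟨H, hH⟩ := hcl.exists_cartan
      exact hH.exists_derivation_lie_eq_lie h2 hcl.center_eq_bot D₁ D₂
    · obtain ⟨u, hu⟩ := LieDerivation.IsKilling.exists_eq_ad ⁅D₁, D₂⁆
      exact ⟨u, fun y => by rw [← hu, LieDerivation.ad_apply_apply]⟩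
  · have := WittPlus.isSimple (F := F) hn
    exact mul_eq_zero_of_derivation_lie_inner two_ne_zero
      (fun D₁ D₂ => WittPlus.exists_derivation_eq_lie _) h
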